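/- Let $D$ be a connected finite directed graph (i.e. its underlying undirected graph is connected) without self-loops, with nodes $1,\dots,n$ and edges $1,\dots,m$. Let $A=(a_{ij})\in\mathbb{R}^{n\times m}$ be its incidence matrix: $a_{ij}=1$ if edge $j$ leaves node $i$, $a_{ij}=-1$ if edge $j$ enters node $i$, and $a_{ij}=0$ otherwise. Let $f_1,\dots,f_m:\mathbb{R}\to\mathbb{R}$ be differentiable, let $f:\mathbb{R}^m\to\mathbb{R}^m$, $f(u)=(f_1(u_1),\dots,f_m(u_m))$, and consider the potential-driven flow $x'=F(x)$ with $F(x)=-Af(A^{T}x)$ on $\mathbb{R}^n$. Let $x^*$ be an equilibrium, $F(x^*)=0$, and give each edge $j$ the weight $W_j=f_j'\big((A^{T}x^*)_j\big)$; put $W=\mathrm{diag}(W_1,\dots,W_m)$. Then $F$ is differentiable at $x^*$ with Jacobian matrix $F'(x^*)=-AWA^{T}$, and: 1. $F'(x^*)$ has corank one (that is, rank $n-1$) if and only if $$\sum_{T}\ \prod_{j\in T}W_j\neq 0,$$ where the sum is over (the edge sets of) all spanning trees $T$ of the underlying undirected graph. 2. If this sum is nonzero, then the set of equilibria is a curve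 locally around $x^*$: there is an open neighbourhood $U$ of $x^*$ such that $\{x\in U: F(x)=0\}$ is an embedded smooth one-dimensional submanifold of $\mathbb{R}^n$. -/

import Mathlib

open scoped ContDiff

/-- A directed graph with nodes `V` and edges `E`: every edge `e` leaves the node `src e` and enters the
node `tgt e`. Parallel and antiparallel edges are allowed, self-loops are not (so that the
incidence matrix is well defined). -/
structure EdgeDigraph (V E : Type*) where
  src : E → V
  tgt : E → V
  loopless : ∀ e, src e ≠ tgt e

namespace EdgeDigraph

variable {V E : Type*}

/-- The undirected simple graph on all the nodes `V` in which two nodes are adjacent when some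
edge in `T` joins them, in either direction. -/
def supportGraph (D : EdgeDigraph V E) (T : Set E) : SimpleGraph V where
  Adj u v := ∃ e ∈ T, (D.src e = u ∧ D.tgt e = v) ∨ (D.src e = v ∧ D.tgt e = u)
  symm := ⟨fun _ _ ⟨e, he, h⟩ => ⟨e, he, h.symm⟩⟩
  loopless := ⟨fun _ ⟨e, _, h⟩ => by
    rcases h with ⟨h1, h2⟩ | ⟨h1, h2⟩ <;> exact D.loopless e (h1.trans h2.symm)⟩

/-- A digraph is connected if its underlying undirected graph is (in particular `V` is
nonempty). -/
def Connected (D : EdgeDigraph V E) : Prop :=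
  (D.supportGraph Set.univ).Connected

/-- A set `T` of edges is (the edge set of) a spanning tree if the undirected multigraph `(V, T)`
is a tree: no two distinct edges of `T` are parallel, and the resulting simple graph on all of `V`
is connected and acyclic. Directions play no role. -/
def IsSpanningTree (D : EdgeDigraph V E) (T : Finset E) : Prop :=
  Set.InjOn (fun e => s(D.src e, D.tgt e)) (T : Set E) ∧ (D.supportGraph (T : Set E)).IsTree

/-- The node-edge incidence matrix: `1` if the edge leaves the node, `-1` if it enters it, and
`0` if it is not incident with it. -/
def incidence [DecidableEq V] (D : EdgeDigraph V E) : Matrix V E ℝ :=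
  Matrix.of fun i e => if D.src e = i then 1 else if D.tgt e = i then -1 else 0

/-- The sum over all spanning trees of the product of the weights of the tree edges. -/
noncomputable def spanningTreeSum [Fintype E] (D : EdgeDigraph V E) (w : E → ℝ) : ℝ :=
  open Classical in ∑ T : Finset E with D.IsSpanningTree T, ∏ e ∈ T, w e

variable [Fintype V] [DecidableEq V] [Fintype E]

/-- The right-hand side `F(x) = -A f(Aᵀ x)` of the potential-driven flow `x' = -A f(Aᵀ x)`, where
`f = ∏ e, f e` is the diagonal map given by the flowrate functions `f e : ℝ → ℝ` of the edges. -/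
def flowField (D : EdgeDigraph V E) (f : E → ℝ → ℝ) (x : V → ℝ) : V → ℝ :=
  -(D.incidence.mulVec fun e => f e ((D.incidence.transpose.mulVec x) e))

/-- The set of equilibria of the flow `x' = F(x)`. -/
def equilibria (D : EdgeDigraph V E) (f : E → ℝ → ℝ) : Set (V → ℝ) :=
  {x | D.flowField f x = 0}

/-- The edge weights at `x`: the derivatives of the flowrate functions there. -/
noncomputable def weight (D : EdgeDigraph V E) (f : E → ℝ → ℝ) (x : V → ℝ) (e : E) : ℝ :=
  deriv (f e) ((D.incidence.transpose.mulVec x) e)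

end EdgeDigraph

/-- The Jacobian matrix of `F : ℝ^V → ℝ^V` at `x`. -/
noncomputable def jacobianMatrix {V : Type*} [Fintype V] [DecidableEq V]
    (F : (V → ℝ) → (V → ℝ)) (x : V → ℝ) : Matrix V V ℝ :=
  LinearMap.toMatrix' (fderiv ℝ F x : (V → ℝ) →ₗ[ℝ] (V → ℝ))

/-- `S` is an embedded smooth submanifold, of dimension `k`, of the finite-dimensional real
space `X`: around each of its points there is a diffeomorphism between open subsets of `X`
that carries `S` onto a `k`-dimensional linear subspace. -/
def IsSmoothSubmanifold {X : Type*} [NormedAddCommGroup X] [NormedSpace ℝ X]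
    [FiniteDimensional ℝ X] (k : ℕ) (S : Set X) : Prop :=
  ∀ x ∈ S, ∃ (Φ : OpenPartialHomeomorph X X) (K : Submodule ℝ X),
    x ∈ Φ.source ∧ ContDiffOn ℝ ∞ Φ Φ.source ∧ ContDiffOn ℝ ∞ Φ.symm Φ.target ∧
      Module.finrank ℝ K = k ∧ ∀ y ∈ Φ.source, y ∈ S ↔ Φ y ∈ K

/-- Locally around `x`, the set `S` is a smooth curve through `x`. -/
def IsCurveNear {X : Type*} [NormedAddCommGroup X] [NormedSpace ℝ X]
    [FiniteDimensional ℝ X] (S : Set X) (x : X) : Prop :=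
  x ∈ S ∧ ∃ U : Set X, IsOpen U ∧ x ∈ U ∧ IsSmoothSubmanifold 1 (S ∩ U)

/-! The Jacobian is minus the weighted Laplacian `A W Aᵀ`, which kills constants, so corank one
means that no nonzero kernel vector vanishes at a chosen node `r`. Since the columns of `A` sum to
zero, this is invertibility of the Laplacian with row and column `r` deleted
(`laplacianInjective_iff_det`). Cauchy–Binet expands its determinant over edge sets of size n - 1,
where spanning trees contribute their weight and all others zero (`det_reduced_eq_spanningTreeSum`).

For the curve, the equilibria are invariant under adding constants. The derivative of `y ↦ (F y, y
r)` at the equilibrium is injective, so no other nearby equilibrium has the same `r`-coordinate.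
Locally the equilibria are therefore exactly a line in the constant direction. -/

open Matrix Finset in
/-- A form of the Cauchy–Binet formula: `det (M * diagonal w * N)` expanded over the subsets of the
inner index type. -/
theorem Matrix.det_mul_diagonal_mul {n E R : Type*} [Fintype n] [DecidableEq n] [Fintype E]
    [DecidableEq E] [CommRing R] (M : Matrix n E R) (N : Matrix E n R) (w : E → R) :
    (M * diagonal w * N).det = ∑ S : Finset E with S.card = Fintype.card n,
      (∏ e ∈ S, w e) * (M * diagonal (fun e => if e ∈ S then (1 : R) else 0) * N).det := by
  -- Multilinearity gives a sum over all maps `p`; a non-injective one repeats a column of `M`.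
  have expand (w : E → R) : (M * diagonal w * N).det =
      ∑ p : n → E with Function.Injective p,
        (∏ i, w (p i)) * ((M.submatrix id p).det * ∏ i, N (p i) i) := by
    have h : (M * diagonal w * N).det =
        ∑ p : n → E, (∏ i, w (p i)) * ((M.submatrix id p).det * ∏ i, N (p i) i) := by
      simp only [det_apply', mul_apply (M := M * diagonal w), mul_diagonal, prod_univ_sum, mul_sum,
        Fintype.piFinset_univ, submatrix_apply, id, sum_mul]
      rw [Finset.sum_comm]
      refine sum_congr rfl fun p _ => sum_congr rfl fun σ _ => ?_
      simp only [prod_mul_distrib]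
      ring
    rw [h]
    refine (sum_subset (filter_subset _ _) fun p _ hp => ?_).symm
    have hp' : ¬ Function.Injective p := by simpa using hp
    simp only [Function.Injective, not_forall] at hp'
    obtain ⟨i, j, hij, hne⟩ := hp'
    have : (M.submatrix id p).det = 0 :=
      det_zero_of_column_eq hne fun k => by simp [hij]
    simp [this]
  rw [expand w]
  have hmaps : ∀ p ∈ ({p : n → E | Function.Injective p} : Finset (n → E)),
      univ.image p ∈ ({S : Finset E | S.card = Fintype.card n} : Finset (Finset E)) := by
    intro p hp
    have hp : Function.Injective p := by simpa using hp
    simp [card_image_of_injective _ hp]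
  rw [← sum_fiberwise_of_maps_to hmaps]
  refine sum_congr rfl fun S hS => ?_
  have hS : S.card = Fintype.card n := by simpa using hS
  -- The same expansion with indicator weights keeps only the injective `p` with image `S`.
  rw [expand, mul_sum, ← sum_filter_add_sum_filter_not
    ({p : n → E | Function.Injective p} : Finset (n → E)) (fun p => univ.image p = S)
    (fun p => (∏ e ∈ S, w e) * ((∏ i, if p i ∈ S then (1 : R) else 0) * _))]
  rw [sum_eq_zero (s := filter (fun p => ¬ univ.image p = S) _), add_zero]
  · refine sum_congr rfl fun p hp => ?_
    simp only [mem_filter, mem_univ, true_and] at hp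
    obtain ⟨hp, rfl⟩ := hp
    rw [prod_image hp.injOn]
    simp
  · intro p hp
    simp only [mem_filter, mem_univ, true_and] at hp
    obtain ⟨hp, hne⟩ := hp
    have : ∃ i, p i ∉ S := by
      by_contra! hall
      refine hne (eq_of_subset_of_card_le (image_subset_iff.2 fun i _ => hall i) ?_)
      rw [card_image_of_injective _ hp, hS, card_univ]
    obtain ⟨i, hi⟩ := this
    rw [prod_eq_zero (mem_univ i) (by simp [hi])]
    simp

namespace EdgeDigraph

variable {V E : Type*}

/-- A set of edges is a spanning tree iff it is connected and has the right number of edges. -/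
theorem isSpanningTree_iff [Fintype V] (D : EdgeDigraph V E) (T : Finset E) :
    D.IsSpanningTree T ↔
      T.card + 1 = Fintype.card V ∧ (D.supportGraph (T : Set E)).Connected := by
  classical
  have hedge : (D.supportGraph (T : Set E)).edgeSet
      = ((T.image fun e => s(D.src e, D.tgt e) : Finset (Sym2 V)) : Set (Sym2 V)) := by
    ext z
    induction z with
    | _ u v => simp [supportGraph]
  have hcard : Nat.card (D.supportGraph (T : Set E)).edgeSet
      = (T.image fun e => s(D.src e, D.tgt e)).card := by
    rw [hedge]; simp
  rw [IsSpanningTree, SimpleGraph.isTree_iff_connected_and_card, hcard, Nat.card_eq_fintype_card,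
    ← Finset.card_image_iff]
  constructor
  · rintro ⟨h1, h2, h3⟩
    exact ⟨by rw [← h1, h3], h2⟩
  · rintro ⟨h1, h2⟩
    -- Connectedness needs at least n - 1 distinct node pairs, so none of the n - 1 edges are
    -- parallel.
    have h3 := h2.card_vert_le_card_edgeSet_add_one
    rw [hcard, Nat.card_eq_fintype_card] at h3
    have h4 : (T.image fun e => s(D.src e, D.tgt e)).card ≤ T.card := Finset.card_image_le
    exact ⟨by omega, h2, by omega⟩

variable [DecidableEq V]

theorem transpose_incidence_mulVec [Fintype V] (D : EdgeDigraph V E) (x : V → ℝ) (e : E) :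
    (D.incidence.transpose.mulVec x) e = x (D.src e) - x (D.tgt e) := by
  have h (i : V) : (if D.src e = i then (1 : ℝ) else if D.tgt e = i then -1 else 0) * x i
      = (if D.src e = i then x i else 0) - (if D.tgt e = i then x i else 0) := by
    by_cases h1 : D.src e = i
    · have h2 : ¬ D.tgt e = i := fun h => D.loopless e (h1.trans h.symm)
      simp [h1, h2]
    · by_cases h2 : D.tgt e = i <;> simp [h1, h2]
  simp [Matrix.mulVec, dotProduct, incidence, h, Finset.sum_sub_distrib]

theorem sum_incidence_mulVec [Fintype V] [Fintype E] (D : EdgeDigraph V E) (g : E → ℝ) :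
    ∑ i, (D.incidence.mulVec g) i = 0 := by
  have h := Matrix.dotProduct_mulVec (fun _ => (1 : ℝ)) D.incidence g
  rw [← Matrix.mulVec_transpose] at h
  have h0 : D.incidence.transpose.mulVec (fun _ => (1 : ℝ)) = 0 := by
    ext e; rw [transpose_incidence_mulVec]; simp
  rw [h0] at h
  simpa [dotProduct] using h

/-! ### The weighted matrix-tree theorem -/

/-- The incidence matrix without the row of the node `r`. -/
noncomputable def reducedIncidence (D : EdgeDigraph V E) (r : V) : Matrix {v // v ≠ r} E ℝ :=
  D.incidence.submatrix Subtype.val id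

theorem transpose_reducedIncidence_mulVec [Fintype V] (D : EdgeDigraph V E) (r : V)
    (x : V → ℝ) (hx : x r = 0) :
    (D.reducedIncidence r).transpose.mulVec (fun i => x i) = D.incidence.transpose.mulVec x := by
  ext e
  simp only [Matrix.mulVec, dotProduct, Matrix.transpose_apply, reducedIncidence,
    Matrix.submatrix_apply, id]
  rw [← Finset.sum_subtype (Finset.univ.filter fun v => v ≠ r) (by simp)
    (fun i => D.incidence i e * x i)]
  refine Finset.sum_subset (Finset.filter_subset _ _) fun i _ hi => ?_
  have hir : i = r := by simpa using hi
  rw [hir, hx, mul_zero]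

-- Over ℤ, `δ r = 0`, and each edge column is a difference of two `δ`s. Walking from `r` along edges
-- of `S` puts every basis vector in the column span, so the integer determinant is a unit.
open Classical in
theorem sq_det_of_connected [Fintype V] [Fintype E] (D : EdgeDigraph V E) (r : V)
    (S : Finset E) (hS : (D.supportGraph (S : Set E)).Connected) (φ : {v // v ≠ r} ≃ S) :
    ((D.reducedIncidence r).submatrix id (fun i => (φ i : E))).det ^ 2 = 1 := by
  set δ : V → ({v // v ≠ r} → ℤ) := fun u i => if u = i then 1 else 0 with hδ
  let Z : Matrix {v // v ≠ r} {v // v ≠ r} ℤ :=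
    Matrix.of fun i j => δ (D.src (φ j)) i - δ (D.tgt (φ j)) i
  have hZ : (D.reducedIncidence r).submatrix id (fun i => (φ i : E)) = Z.map (Int.cast : ℤ → ℝ) := by
    ext i j
    by_cases h1 : D.src (φ j) = i
    · have h2 : ¬ D.tgt (φ j) = i := fun h => D.loopless _ (h1.trans h.symm)
      simp [Z, hδ, reducedIncidence, incidence, h1, h2]
    · by_cases h2 : D.tgt (φ j) = i <;> simp [Z, hδ, reducedIncidence, incidence, h1, h2]
  have hstep : ∀ e ∈ S, δ (D.src e) - δ (D.tgt e) ∈ LinearMap.range Z.mulVecLin := by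
    intro e he
    refine ⟨Pi.single (φ.symm ⟨e, he⟩) 1, ?_⟩
    ext i
    simp [Z]
  have hδmem : ∀ u, δ u ∈ LinearMap.range Z.mulVecLin := by
    intro u
    have hr := (SimpleGraph.reachable_iff_reflTransGen _ _).1 (hS.preconnected r u)
    induction hr with
    | refl =>
      have : δ r = 0 := by ext i; simp [hδ, i.2.symm]
      rw [this]; exact zero_mem _
    | tail _ hadj ih =>
      obtain ⟨e, he, ⟨rfl, rfl⟩ | ⟨rfl, rfl⟩⟩ := hadj
      · have := sub_mem ih (hstep e he)
        simpa using this
      · have := add_mem (hstep e he) ih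
        simpa using this
  have hsurj : Function.Surjective Z.mulVec := by
    intro y
    have : y = ∑ i, y i • δ i := by
      ext j
      simp [hδ, Subtype.val_inj]
    have hy : y ∈ LinearMap.range Z.mulVecLin := by
      rw [this]
      exact Submodule.sum_mem _ fun i _ => Submodule.smul_mem _ _ (hδmem i)
    exact hy
  have hunit : IsUnit Z.det :=
    (Matrix.isUnit_iff_isUnit_det _).1 (Matrix.mulVec_surjective_iff_isUnit.1 hsurj)
  have hdet : (Z.map (Int.cast : ℤ → ℝ)).det = (Z.det : ℝ) :=
    ((Int.castRingHom ℝ).map_det Z).symm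
  rw [hZ, hdet]
  exact_mod_cast Int.isUnit_sq hunit

theorem det_reduced_of_connected [Fintype V] [Fintype E] [DecidableEq E] (D : EdgeDigraph V E)
    (r : V) (S : Finset E) (hcard : S.card = Fintype.card {v // v ≠ r})
    (hS : (D.supportGraph (S : Set E)).Connected) :
    (D.reducedIncidence r * Matrix.diagonal (fun e => if e ∈ S then (1 : ℝ) else 0) *
      (D.reducedIncidence r).transpose).det = 1 := by
  classical
  let φ : {v // v ≠ r} ≃ S := Fintype.equivOfCardEq (by simp [hcard])
  have h := D.sq_det_of_connected r S hS φ
  have hmul : D.reducedIncidence r * Matrix.diagonal (fun e => if e ∈ S then (1 : ℝ) else 0) *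
      (D.reducedIncidence r).transpose =
      ((D.reducedIncidence r).submatrix id (fun i => (φ i : E))) *
      ((D.reducedIncidence r).submatrix id (fun i => (φ i : E))).transpose := by
    ext i j
    rw [Matrix.mul_apply, Matrix.mul_apply]
    simp only [Matrix.mul_diagonal, Matrix.transpose_apply, Matrix.submatrix_apply, id]
    rw [φ.sum_comp (fun s : S => D.reducedIncidence r i s * D.reducedIncidence r j s),
      Finset.sum_coe_sort S (fun s => D.reducedIncidence r i s * D.reducedIncidence r j s)]
    simp [Finset.sum_ite_mem]
  rw [hmul, Matrix.det_mul, Matrix.det_transpose, ← sq]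
  convert h

/-- The indicator of the nodes not reachable from `r` is a nonzero kernel vector: it is constant
along every edge of `S`. -/
theorem det_reduced_of_not_connected [Fintype V] [Fintype E] [DecidableEq E]
    (D : EdgeDigraph V E) (r : V) (S : Finset E)
    (hS : ¬ (D.supportGraph (S : Set E)).Connected) :
    (D.reducedIncidence r * Matrix.diagonal (fun e => if e ∈ S then (1 : ℝ) else 0) *
      (D.reducedIncidence r).transpose).det = 0 := by
  classical
  rw [← Matrix.exists_mulVec_eq_zero_iff]
  obtain ⟨u, hu⟩ : ∃ u, ¬ (D.supportGraph (S : Set E)).Reachable r u := by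
    by_contra! h
    exact hS ((SimpleGraph.connected_iff _).2 ⟨fun a b => (h a).symm.trans (h b), ⟨r⟩⟩)
  let x : V → ℝ := fun v => if (D.supportGraph (S : Set E)).Reachable r v then 0 else 1
  refine ⟨fun i => x i, fun h => ?_, ?_⟩
  · have hur : u ≠ r := fun h => hu (h ▸ SimpleGraph.Reachable.refl _)
    have := congrFun h ⟨u, hur⟩
    simp [x, hu] at this
  · rw [← Matrix.mulVec_mulVec, D.transpose_reducedIncidence_mulVec r x (by simp [x]),
      ← Matrix.mulVec_mulVec]
    suffices h0 : (Matrix.diagonal (fun e => if e ∈ S then (1 : ℝ) else 0)).mulVec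
        (D.incidence.transpose.mulVec x) = 0 by rw [h0, Matrix.mulVec_zero]
    ext e
    rw [Matrix.mulVec_diagonal, transpose_incidence_mulVec]
    by_cases he : e ∈ S
    · have hadj : (D.supportGraph (S : Set E)).Adj (D.src e) (D.tgt e) :=
        ⟨e, he, Or.inl ⟨rfl, rfl⟩⟩
      have : (D.supportGraph (S : Set E)).Reachable r (D.src e) ↔
          (D.supportGraph (S : Set E)).Reachable r (D.tgt e) :=
        ⟨fun h => h.trans hadj.reachable, fun h => h.trans hadj.symm.reachable⟩
      simp [x, this]
    · simp [he]

/-- The weighted matrix-tree theorem. -/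
theorem det_reduced_eq_spanningTreeSum [Fintype V] [Fintype E] [DecidableEq E]
    (D : EdgeDigraph V E) (r : V) (w : E → ℝ) :
    (D.reducedIncidence r * Matrix.diagonal w * (D.reducedIncidence r).transpose).det =
      D.spanningTreeSum w := by
  classical
  have hV : Fintype.card {v // v ≠ r} + 1 = Fintype.card V := by
    have : 0 < Fintype.card V := Fintype.card_pos_iff.2 ⟨r⟩
    rw [Fintype.card_subtype_compl]
    simp only [Fintype.card_unique]
    omega
  rw [Matrix.det_mul_diagonal_mul, spanningTreeSum]
  symm
  refine Finset.sum_congr_of_eq_on_inter ?_ ?_ ?_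
  · intro T hT hT'
    simp only [Finset.mem_filter, Finset.mem_univ, true_and, isSpanningTree_iff] at hT hT'
    omega
  · intro T hT hT'
    simp only [Finset.mem_filter, Finset.mem_univ, true_and, isSpanningTree_iff] at hT hT'
    rw [det_reduced_of_not_connected, mul_zero]
    intro h
    exact hT' ⟨by omega, h⟩
  · intro T hT hT'
    simp only [Finset.mem_filter, Finset.mem_univ, true_and, isSpanningTree_iff] at hT hT'
    rw [D.det_reduced_of_connected r T hT' hT.2, mul_one]

/-! ### Corank one and the grounded Laplacian -/

/-- Up to constants, the weighted Laplacian is injective. -/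
def LaplacianInjective [Fintype V] [Fintype E] [DecidableEq E] (D : EdgeDigraph V E) (r : V)
    (w : E → ℝ) : Prop :=
  ∀ v : V → ℝ, (D.incidence * Matrix.diagonal w * D.incidence.transpose).mulVec v = 0 →
    v r = 0 → v = 0

theorem laplacianInjective_iff_det [Fintype V] [Fintype E] [DecidableEq E]
    (D : EdgeDigraph V E) (r : V) (w : E → ℝ) :
    D.LaplacianInjective r w ↔ D.spanningTreeSum w ≠ 0 := by
  have hrows (v : V → ℝ) (hv : v r = 0) (i : {v // v ≠ r}) :
      ((D.reducedIncidence r * Matrix.diagonal w *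
        (D.reducedIncidence r).transpose).mulVec (fun j => v j)) i =
      ((D.incidence * Matrix.diagonal w * D.incidence.transpose).mulVec v) i := by
    rw [← Matrix.mulVec_mulVec, D.transpose_reducedIncidence_mulVec r v hv,
      ← Matrix.mulVec_mulVec, ← Matrix.mulVec_mulVec, ← Matrix.mulVec_mulVec]
    rfl
  rw [← D.det_reduced_eq_spanningTreeSum r w, ne_eq, ← Matrix.exists_mulVec_eq_zero_iff]
  constructor
  · rintro h ⟨u, hu, hu0⟩
    let v : V → ℝ := fun i => if hi : i ≠ r then u ⟨i, hi⟩ else 0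
    have hvr : v r = 0 := by simp [v]
    have hvu : (fun j : {v // v ≠ r} => v j) = u := by
      ext j; simp [v, j.2]
    have hv : v = 0 := by
      refine h v ?_ hvr
      have hne : ∀ i, i ≠ r →
          ((D.incidence * Matrix.diagonal w * D.incidence.transpose).mulVec v) i = 0 := by
        intro i hi
        rw [← hrows v hvr ⟨i, hi⟩, hvu, hu0]; rfl
      ext i
      by_cases hi : i = r
      · subst hi
        -- The entries of the image sum to zero, so the deleted equation at `r` follows from the
        -- others.
        have hs := D.sum_incidence_mulVec
          ((Matrix.diagonal w).mulVec (D.incidence.transpose.mulVec v))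
        rw [Matrix.mulVec_mulVec, Matrix.mulVec_mulVec,
          Finset.sum_eq_single i (fun j _ hj => hne j hj) (by simp)] at hs
        exact hs
      · exact hne i hi
    apply hu
    rw [← hvu, hv]; rfl
  · intro h v hv hvr
    by_contra hne
    refine h ⟨fun j => v j, fun h0 => hne ?_, ?_⟩
    · ext i
      by_cases hi : i = r
      · rw [hi, hvr]; rfl
      · exact congrFun h0 ⟨i, hi⟩
    · ext i
      rw [hrows v hvr, hv]; rfl

theorem laplacian_mulVec_const [Fintype V] [Fintype E] [DecidableEq E] (D : EdgeDigraph V E)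
    (w : E → ℝ) (c : ℝ) :
    (D.incidence * Matrix.diagonal w * D.incidence.transpose).mulVec (fun _ => c) = 0 := by
  have h0 : D.incidence.transpose.mulVec (fun _ => c) = 0 := by
    ext e; rw [transpose_incidence_mulVec]; simp
  rw [← Matrix.mulVec_mulVec, h0, Matrix.mulVec_zero]

theorem rank_laplacian_iff [Fintype V] [Fintype E] [DecidableEq E]
    (D : EdgeDigraph V E) (r : V) (w : E → ℝ) :
    (D.incidence * Matrix.diagonal w * D.incidence.transpose).rank + 1 = Fintype.card V ↔
      D.LaplacianInjective r w := by
  set L := D.incidence * Matrix.diagonal w * D.incidence.transpose with hL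
  have hdim := L.mulVecLin.finrank_range_add_finrank_ker
  rw [Module.finrank_fintype_fun_eq_card] at hdim
  have hker (c : ℝ) : (fun _ => c : V → ℝ) ∈ LinearMap.ker L.mulVecLin :=
    D.laplacian_mulVec_const w c
  have hne : (⟨fun _ => 1, hker 1⟩ : LinearMap.ker L.mulVecLin) ≠ 0 := by
    intro h
    have := congrFun (congrArg Subtype.val h) r
    simp at this
  have : L.rank + 1 = Fintype.card V ↔ Module.finrank ℝ (LinearMap.ker L.mulVecLin) = 1 := by
    rw [Matrix.rank]; omega
  rw [this, finrank_eq_one_iff_of_nonzero' _ hne]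
  constructor
  · intro h v hv hvr
    obtain ⟨c, hc⟩ := h ⟨v, hv⟩
    have hc' : ∀ i, c = v i := fun i => by
      simpa using congrFun (congrArg Subtype.val hc) i
    ext i
    rw [← hc' i, hc' r, hvr]; rfl
  · rintro h ⟨v, hv⟩
    refine ⟨v r, Subtype.ext ?_⟩
    have h0 := h (v - fun _ => v r) (by
      have := sub_mem hv (hker (v r))
      exact this) (by simp)
    rw [sub_eq_zero] at h0
    ext i
    simpa using (congrFun h0 i).symm

/-! ### The Jacobian and the curve of equilibria -/

theorem flowField_sub_const [Fintype V] [Fintype E] (D : EdgeDigraph V E) (f : E → ℝ → ℝ)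
    (y : V → ℝ) (c : ℝ) : D.flowField f (fun i => y i - c) = D.flowField f y := by
  simp [flowField, transpose_incidence_mulVec]

theorem hasFDerivAt_flowField [Fintype V] [Fintype E] [DecidableEq E] (D : EdgeDigraph V E)
    (f : E → ℝ → ℝ) (x : V → ℝ)
    (hf : ∀ e, DifferentiableAt ℝ (f e) ((D.incidence.transpose.mulVec x) e)) :
    HasFDerivAt (D.flowField f) (LinearMap.toContinuousLinearMap (Matrix.toLin'
      (-(D.incidence * Matrix.diagonal (D.weight f x) * D.incidence.transpose)))) x := by
  have h1 : HasFDerivAt (fun y : V → ℝ => D.incidence.transpose.mulVec y)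
      (LinearMap.toContinuousLinearMap (Matrix.toLin' D.incidence.transpose)) x :=
    (LinearMap.toContinuousLinearMap (Matrix.toLin' D.incidence.transpose)).hasFDerivAt
  have h2 : HasFDerivAt (fun u : E → ℝ => fun e => f e (u e))
      (LinearMap.toContinuousLinearMap (Matrix.toLin' (Matrix.diagonal (D.weight f x))))
      (D.incidence.transpose.mulVec x) := by
    rw [hasFDerivAt_pi']
    intro e
    have := (hf e).hasDerivAt.hasFDerivAt.comp (D.incidence.transpose.mulVec x)
      (ContinuousLinearMap.proj (R := ℝ) (φ := fun _ : E => ℝ) e).hasFDerivAt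
    refine this.congr_fderiv ?_
    ext u
    simp [Matrix.mulVec_diagonal, weight, mul_comm]
  have h3 : HasFDerivAt (fun u : E → ℝ => D.incidence.mulVec u)
      (LinearMap.toContinuousLinearMap (Matrix.toLin' D.incidence))
      (fun e => f e ((D.incidence.transpose.mulVec x) e)) :=
    (LinearMap.toContinuousLinearMap (Matrix.toLin' D.incidence)).hasFDerivAt
  refine ((h3.comp x (h2.comp x h1)).neg).congr_fderiv ?_
  ext1 u
  simp [Matrix.mul_assoc]

-- Differentiability at the single point `x` does not support the implicit function theorem;
-- translation invariance replaces it.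
open Topology in
theorem isCurveNear_equilibria [Fintype V] [Fintype E] [DecidableEq E] (D : EdgeDigraph V E)
    (f : E → ℝ → ℝ) (x : V → ℝ) (hx : x ∈ D.equilibria f)
    (hf : ∀ e, DifferentiableAt ℝ (f e) ((D.incidence.transpose.mulVec x) e)) (r : V)
    (h : D.LaplacianInjective r (D.weight f x)) : IsCurveNear (D.equilibria f) x := by
  let G' : (V → ℝ) →L[ℝ] (V → ℝ) × ℝ :=
    (LinearMap.toContinuousLinearMap (Matrix.toLin' (-(D.incidence *
      Matrix.diagonal (D.weight f x) * D.incidence.transpose)))).prod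
      (ContinuousLinearMap.proj r)
  have hG : HasFDerivAt (fun y : V → ℝ => (D.flowField f y, y r)) G' x :=
    (D.hasFDerivAt_flowField f x hf).prodMk
      (ContinuousLinearMap.proj (R := ℝ) (φ := fun _ : V => ℝ) r).hasFDerivAt
  have hinj : LinearMap.ker (G' : (V → ℝ) →ₗ[ℝ] (V → ℝ) × ℝ) = ⊥ := by
    rw [LinearMap.ker_eq_bot']
    intro v hv
    have hv' := Prod.ext_iff.1 hv
    refine h v ?_ hv'.2
    have := hv'.1
    simpa [G', Matrix.neg_mulVec, Matrix.mul_assoc] using this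
  obtain ⟨K, -, hK⟩ := LinearMap.exists_antilipschitzWith _ hinj
  have hev := hG.eventually_ne (c := (0, x r)) ⟨K, hK⟩
  rw [eventually_nhdsWithin_iff] at hev
  obtain ⟨O, hO, hOo, hxO⟩ := eventually_nhds_iff.1 hev
  -- `π` slides `y` along the constants until its `r`-coordinate is `x r`; the neighbourhood is the
  -- tube `π ⁻¹' O`.
  let π : (V → ℝ) → V → ℝ := fun y i => y i - (y r - x r)
  have hπ : Continuous π := by fun_prop
  have hπx : π x = x := by ext i; simp [π]
  have hmem : ∀ y, y ∈ D.equilibria f ∩ π ⁻¹' O ↔ π y = x := by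
    intro y
    have hF : D.flowField f (π y) = D.flowField f y := D.flowField_sub_const f y _
    constructor
    · rintro ⟨hy, hyO⟩
      by_contra hne
      refine hO _ hyO hne ?_
      rw [hF]
      exact Prod.ext hy (by simp [π])
    · intro hy
      refine ⟨?_, by rw [Set.mem_preimage, hy]; exact hxO⟩
      change D.flowField f y = 0
      rw [← hF, hy]; exact hx
  refine ⟨hx, π ⁻¹' O, hOo.preimage hπ, by rw [Set.mem_preimage, hπx]; exact hxO, ?_⟩
  intro p _
  -- In the tube the equilibria are a whole affine line, so one global translation serves as chart
  -- at every point.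
  refine ⟨(Homeomorph.addRight (-x)).toOpenPartialHomeomorph,
    Submodule.span ℝ {(fun _ => 1 : V → ℝ)}, by simp, ?_, ?_, ?_, ?_⟩
  · exact (contDiff_id.add contDiff_const).contDiffOn
  · exact (contDiff_id.add contDiff_const).contDiffOn
  · refine finrank_span_singleton fun h0 => ?_
    simpa using congrFun h0 r
  · intro y _
    rw [hmem, Submodule.mem_span_singleton]
    constructor
    · intro hy
      refine ⟨y r - x r, ?_⟩
      ext i
      have := congrFun hy i
      simp only [π] at this
      simp
      linarith
    · rintro ⟨c, hc⟩
      have hc' : ∀ i, c = y i - x i := fun i => by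
        have := congrFun hc i
        simp at this
        linarith
      ext i
      have h1 := hc' i
      have h2 := hc' r
      simp only [π]
      linarith

end EdgeDigraph

theorem theorem3 {V E : Type*} [Fintype V] [DecidableEq V] [Fintype E] [DecidableEq E]
    (D : EdgeDigraph V E) (hD : D.Connected)
    (f : E → ℝ → ℝ) (hf : ∀ e, Differentiable ℝ (f e))
    (x : V → ℝ) (hx : x ∈ D.equilibria f) :
    DifferentiableAt ℝ (D.flowField f) x ∧
    jacobianMatrix (D.flowField f) x =
      -(D.incidence * Matrix.diagonal (D.weight f x) * D.incidence.transpose) ∧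
    ((jacobianMatrix (D.flowField f) x).rank + 1 = Fintype.card V ↔
      D.spanningTreeSum (D.weight f x) ≠ 0) ∧
    (D.spanningTreeSum (D.weight f x) ≠ 0 → IsCurveNear (D.equilibria f) x) := by
  obtain ⟨r⟩ := hD.nonempty
  have hF := D.hasFDerivAt_flowField f x fun e => (hf e).differentiableAt
  have hJ : jacobianMatrix (D.flowField f) x =
      -(D.incidence * Matrix.diagonal (D.weight f x) * D.incidence.transpose) := by
    rw [jacobianMatrix, hF.fderiv]
    exact LinearMap.toMatrix'_toLin' _
  have hrank (M : Matrix V V ℝ) : (-M).rank = M.rank := by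
    rw [← neg_one_smul ℝ M, Matrix.rank_smul_of_mem_nonZeroDivisors M (by simp)]
  refine ⟨hF.differentiableAt, hJ, ?_, fun h => ?_⟩
  · rw [hJ, hrank, D.rank_laplacian_iff r, D.laplacianInjective_iff_det r]
  · exact D.isCurveNear_equilibria f x hx (fun e => (hf e).differentiableAt) r
      ((D.laplacianInjective_iff_det r _).2 h)
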